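/- Let $V$ be a finite set. For a directed acyclic graph (DAG) $G$ on $V$, a set $A\subseteq V$ is ancestral in $G$ if it contains the parents of each of its elements; $G_A$ is the induced subgraph with vertex set $A$; $\mathrm{an}_G(B)$ is the smallest ancestral set containing $B$; and the moral graph of $G$ is its skeleton with an edge added between any two vertices that have a common child. The semi-graphoid of $G$ is the set of triples $\langle A,B\mid C\rangle$ of subsets of $V$ such that $A$ and $B$ are separated by $C$ in the moral graph of $G_{\mathrm{an}_G(A\cup B\cup C)}$. Two DAGs are Markov equivalent if their semi-graphoids are equal. A dagoid on $V$ is a Markov equivalence class $D=[G]$ of DAGs on $V$. A set $A\subseteq V$ is ancestral in $D$ if it is ancestral in some $G\in D$, and $\mathfrak A(A)$ denotes the set of dagoids on $V$ in which $A$ is ancestral. For a DAG $H$ on $A$ and a DAG $G$ on $V$ in which $A$ is ancestral, let $H\ltimes G$ be the DAG on $V$ with edge set $E(H)\cup(E(G)\setminus A^2)$. For $D\in\mathfrak A(A)$ and a dagoid $K$ on $A$, choose $G\in D$ in which $A$ is ancestral and $H\in K$, and define the induced dagoid $D_A=[G_A]$, the ancestral insertion $K\ltimes D=[H\ltimes G]\in\mathfrak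 A(A)$, and the remainder dagoid $D_{V\mid A}=C^{(A)}\ltimes D\in\mathfrak A(A)$, where $C^{(A)}$ is the complete dagoid on $A$, i.e. the class of the complete DAGs on $A$. Theorem. For any $A\subseteq V$, the dagoids $D_A$, $K\ltimes D$ and $D_{V\mid A}$ do not depend on the chosen representatives (including the choice of the complete DAG on $A$), and $D_A$ and $D_{V\mid A}$ are variation independent over $D\in\mathfrak A(A)$, that is, $$\{(D_A,D_{V\mid A}) : D\in\mathfrak A(A)\}=\{D_A : D\in\mathfrak A(A)\}\times\{D_{V\mid A} : D\in\mathfrak A(A)\}.$$ Moreover, for all $D,D'\in\mathfrak A(A)$ the ancestral insertion $D^*=D_A\ltimes D'_{V\mid A}$ satisfies $D^*_A=D_A$ and $D^*_{V\mid A}=D'_{V\mid A}$, and it is the only dagoid in $\mathfrak A(A)$ with these two properties. -/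

import Mathlib

/-- A directed acyclic graph on `V`: a directed graph that admits a compatible well-ordering of
its vertices, i.e. one with `u ≺ v` for every arrow `u → v`. -/
structure DAG (V : Type*) extends Digraph V where
  acyclic : ∃ r : V → V → Prop, IsWellOrder V r ∧ ∀ u v, Adj u v → r u v

/-- `A` and `B` are separated by `S` in the undirected graph `G`: every path (sequence of
successively adjacent vertices, possibly of length `0`) from `A` to `B` meets `S`. -/
def SimpleGraph.SeparatedBy {W : Type*} (G : SimpleGraph W) (A B S : Set W) : Prop :=
  ∀ a ∈ A, ∀ b ∈ B, ∀ p : G.Walk a b, ∃ s ∈ p.support, s ∈ S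

namespace DAG

variable {V : Type*}

/-- The induced subgraph `G_A`, with vertex set `A`. -/
def induce (G : DAG V) (A : Set V) : DAG A where
  Adj u v := G.Adj u v
  acyclic := by
    obtain ⟨r, hr, h⟩ := G.acyclic
    exact ⟨Subrel r (· ∈ A), inferInstance, fun u v huv => h u v huv⟩

/-- A set of vertices is ancestral if it contains the parents of each of its elements. -/
def IsAncestral (G : DAG V) (A : Set V) : Prop :=
  ∀ v ∈ A, ∀ u, G.Adj u v → u ∈ A

/-- `an_G(B)`, the smallest ancestral set containing `B`. -/
def an (G : DAG V) (B : Set V) : Set V :=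
  ⋂₀ {S | G.IsAncestral S ∧ B ⊆ S}

/-- The moral graph: the skeleton, with an edge added between any two vertices that have a common
child. -/
def moral (G : DAG V) : SimpleGraph V where
  Adj u v := u ≠ v ∧ (G.Adj u v ∨ G.Adj v u ∨ ∃ w, G.Adj u w ∧ G.Adj v w)
  symm := ⟨fun _ _ ⟨hne, h⟩ => ⟨hne.symm, by
    rcases h with h | h | ⟨w, h₁, h₂⟩
    · exact Or.inr (Or.inl h)
    · exact Or.inl h
    · exact Or.inr (Or.inr ⟨w, h₂, h₁⟩)⟩⟩
  loopless := ⟨fun _ h => h.1 rfl⟩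

/-- The semi-graphoid `M(G)` of `G` (its global Markov property): the set of triples
`⟨A, B | C⟩` of subsets of `V` such that `A` and `B` are separated by `C` in the moral graph of
the subgraph of `G` induced by `an_G(A ∪ B ∪ C)`. -/
def markov (G : DAG V) : Set (Set V × Set V × Set V) :=
  {t | (G.induce (G.an (t.1 ∪ t.2.1 ∪ t.2.2))).moral.SeparatedBy
    (Subtype.val ⁻¹' t.1) (Subtype.val ⁻¹' t.2.1) (Subtype.val ⁻¹' t.2.2)}

/-- There is an edge between every pair of distinct vertices. -/
def IsComplete (G : DAG V) : Prop :=
  ∀ u v, u ≠ v → G.Adj u v ∨ G.Adj v u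

/-- A complete DAG on `V`, with the arrows directed along some well-ordering of `V`. -/
def complete (V : Type*) : DAG V where
  Adj := WellOrderingRel
  acyclic := ⟨WellOrderingRel, inferInstance, fun _ _ h => h⟩

theorem isComplete_complete : (complete V).IsComplete := fun u v h =>
  (trichotomous_of (WellOrderingRel : V → V → Prop) u v).imp_right fun h' => h'.resolve_left h

/-- The insertion `H ⋉ G` of a DAG `H` on `A` into a DAG `G` on `V` in which `A` is ancestral:
the DAG on `V` with edge set `E(H) ∪ (E(G) \ A²)`. -/
def insertion {A : Set V} (H : DAG A) (G : DAG V) (hA : G.IsAncestral A) : DAG V where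
  Adj u v := (∃ (hu : u ∈ A) (hv : v ∈ A), H.Adj ⟨u, hu⟩ ⟨v, hv⟩) ∨
    (G.Adj u v ∧ ¬ (u ∈ A ∧ v ∈ A))
  acyclic := by
    classical
    obtain ⟨r, hr, h⟩ := H.acyclic
    obtain ⟨s, hs, h'⟩ := G.acyclic
    let e : V ≃ A ⊕ (Aᶜ : Set V) := (Equiv.Set.sumCompl A).symm
    let t := Sum.Lex r (Subrel s (· ∈ Aᶜ))
    have ht : IsWellOrder V (e ⁻¹'o t) := (RelIso.preimage e t).toRelEmbedding.isWellOrder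
    refine ⟨e ⁻¹'o t, ht, ?_⟩
    rintro u v (⟨hu, hv, huv⟩ | ⟨huv, hn⟩)
    · have h1 : e u = Sum.inl ⟨u, hu⟩ := Equiv.Set.sumCompl_symm_apply_of_mem hu
      have h2 : e v = Sum.inl ⟨v, hv⟩ := Equiv.Set.sumCompl_symm_apply_of_mem hv
      simpa [Order.Preimage, h1, h2, t] using h _ _ huv
    · have hv : v ∉ A := fun hv => hn ⟨hA v hv u huv, hv⟩
      have h2 : e v = Sum.inr ⟨v, hv⟩ := Equiv.Set.sumCompl_symm_apply_of_notMem hv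
      by_cases hu : u ∈ A
      · have h1 : e u = Sum.inl ⟨u, hu⟩ := Equiv.Set.sumCompl_symm_apply_of_mem hu
        simp [Order.Preimage, h1, h2, t]
      · have h1 : e u = Sum.inr ⟨u, hu⟩ := Equiv.Set.sumCompl_symm_apply_of_notMem hu
        simpa [Order.Preimage, h1, h2, t] using h' _ _ huv

theorem insertion_isAncestral {A : Set V} (H : DAG A) (G : DAG V) (hA : G.IsAncestral A) :
    (H.insertion G hA).IsAncestral A := by
  rintro v hv u (⟨hu, -, -⟩ | ⟨huv, -⟩)
  · exact hu
  · exact hA v hv u huv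

/-- Markov equivalence of DAGs: equality of the semi-graphoids. -/
instance markovEquiv (V : Type*) : Setoid (DAG V) :=
  Setoid.ker markov

end DAG

/-- A dagoid on `V`: a Markov equivalence class of DAGs on `V`. -/
def Dagoid (V : Type*) : Type _ := Quotient (DAG.markovEquiv V)

namespace Dagoid

variable {V : Type*}

/-- The Markov equivalence class `[G]` of a DAG. -/
def mk (G : DAG V) : Dagoid V := Quotient.mk (DAG.markovEquiv V) G

/-- The set of dagoids on `V` in which `A` is ancestral, i.e. in which `A` is ancestral for some
graph of the class. -/
def ances (A : Set V) : Set (Dagoid V) :=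
  {D | ∃ G : DAG V, mk G = D ∧ G.IsAncestral A}

theorem mk_mem_ances {A : Set V} {G : DAG V} (hA : G.IsAncestral A) : mk G ∈ ances A :=
  ⟨G, rfl, hA⟩

/-- Some graph of the dagoid `D` in which `A` is ancestral. -/
noncomputable def rep {A : Set V} (D : ances A) : DAG V := D.2.choose

theorem mk_rep {A : Set V} (D : ances A) : mk (rep D) = D.1 := D.2.choose_spec.1

theorem rep_isAncestral {A : Set V} (D : ances A) : (rep D).IsAncestral A := D.2.choose_spec.2

/-- The subdagoid `D_A` induced by an ancestral set `A`: the class of `G_A`, where `G` is a graph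
of `D` in which `A` is ancestral. -/
noncomputable def induced {A : Set V} (D : ances A) : Dagoid A :=
  mk ((rep D).induce A)

/-- The ancestral insertion `K ⋉ D = [H ⋉ G]` of a dagoid `K` on `A` into a dagoid `D` in which
`A` is ancestral, where `H` is a graph of `K`, and `G` is a graph of `D` in which `A` is
ancestral. It is again a dagoid in which `A` is ancestral. -/
noncomputable def insertion {A : Set V} (K : Dagoid A) (D : ances A) : ances A :=
  ⟨mk ((Quotient.out K).insertion (rep D) (rep_isAncestral D)),
    mk_mem_ances (DAG.insertion_isAncestral _ _ _)⟩

/-- The complete dagoid: the class of the complete DAGs. -/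
def complete (V : Type*) : Dagoid V := mk (DAG.complete V)

/-- The remainder dagoid `D_{V|A}` of `D` given `A`: the insertion of the complete dagoid on `A`
into `D`. -/
noncomputable def remainder {A : Set V} (D : ances A) : ances A :=
  insertion (complete A) D

end Dagoid

/-- Two functions of an element `ω` of `Ω` are variation independent if each possible value of the
one may occur together with each possible value of the other: their joint range is the product of
their ranges. -/
def VariationIndep {Ω α β : Type*} (f : Ω → α) (g : Ω → β) : Prop :=
  Set.range (fun ω => (f ω, g ω)) = Set.range f ×ˢ Set.range g

namespace DAG

variable {V : Type*}

/-! Everything rests on the Verma–Pearl criterion `markov_eq_iff_samePattern`: on a finite vertex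
set, two DAGs are Markov equivalent iff they share skeleton and immoralities. One direction reads
adjacency and immoralities off separations; the other passes between the DAGs by reversing covered
arrows, each reversal preserving the semi-graphoid.

Restriction to `A` visibly respects patterns. So does insertion (`SamePattern.insertion`), because
ancestrality of `A` fixes the direction of every arrow between `A` and its complement. Hence the
operations descend to dagoids, together with the DAG identities (H ⋉ G)_A = H, H ⋉ (H' ⋉ G) = H ⋉ G
and G_A ⋉ G = G. The first two give existence, hence variation independence; the last two give
uniqueness. -/

theorem wellFounded_adj (G : DAG V) : WellFounded G.Adj := by
  obtain ⟨r, hr, h⟩ := G.acyclic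
  exact Subrelation.wf (fun {u v} huv => h u v huv) hr.wf

theorem wellFounded_swap_adj [Finite V] (G : DAG V) : WellFounded (Function.swap G.Adj) := by
  obtain ⟨r, hr, h⟩ := G.acyclic
  have : WellFounded (Function.swap r) := Finite.wellFounded_of_trans_of_irrefl _
  exact Subrelation.wf (fun {u v} huv => h v u huv) this

theorem not_adj_self (G : DAG V) (v : V) : ¬ G.Adj v v :=
  fun h => G.wellFounded_adj.asymmetric _ _ h h

theorem not_adj_symm (G : DAG V) {u v : V} (h : G.Adj u v) : ¬ G.Adj v u :=
  G.wellFounded_adj.asymmetric _ _ h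

theorem not_adj_cycle (G : DAG V) {u v w : V} (h : G.Adj u v) (h' : G.Adj v w) : ¬ G.Adj w u := by
  obtain ⟨r, hr, hG⟩ := G.acyclic
  exact fun h'' => irrefl_of r u (_root_.trans (_root_.trans (hG _ _ h) (hG _ _ h')) (hG _ _ h''))

theorem ext_adj {G H : DAG V} (h : ∀ u v, G.Adj u v ↔ H.Adj u v) : G = H := by
  obtain ⟨⟨_⟩, _⟩ := G
  obtain ⟨⟨_⟩, _⟩ := H
  simp only [mk.injEq, Digraph.mk.injEq]
  ext u v
  exact h u v

/-! ### Ancestral sets, families and moral separation -/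

theorem subset_an (G : DAG V) (B : Set V) : B ⊆ G.an B :=
  fun _ hb => Set.mem_sInter.2 fun _ hS => hS.2 hb

theorem an_subset {G : DAG V} {B S : Set V} (hS : G.IsAncestral S) (h : B ⊆ S) : G.an B ⊆ S :=
  Set.sInter_subset_of_mem ⟨hS, h⟩

theorem isAncestral_an (G : DAG V) (B : Set V) : G.IsAncestral (G.an B) :=
  fun v hv u huv => Set.mem_sInter.2 fun S hS => hS.1 v (Set.mem_sInter.1 hv S hS) u huv

/-- The family of a vertex: the vertex together with its parents. -/
def family (G : DAG V) (w : V) : Set V :=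
  {u | u = w ∨ G.Adj u w}

theorem moral_adj_iff (G : DAG V) {u v : V} :
    G.moral.Adj u v ↔ u ≠ v ∧ ∃ w, u ∈ G.family w ∧ v ∈ G.family w := by
  simp only [moral, family, Set.mem_ofPred_eq]
  refine and_congr_right fun hne => ⟨?_, ?_⟩
  · rintro (h | h | ⟨w, h, h'⟩)
    · exact ⟨v, .inr h, .inl rfl⟩
    · exact ⟨u, .inl rfl, .inr h⟩
    · exact ⟨w, .inr h, .inr h'⟩
  · rintro ⟨w, rfl | h, rfl | h'⟩
    · exact (hne rfl).elim
    · exact .inr (.inl h')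
    · exact .inl h
    · exact .inr (.inr ⟨w, h, h'⟩)

theorem induce_mem_family {G : DAG V} {S : Set V} {u w : S} :
    u ∈ (G.induce S).family w ↔ (u : V) ∈ G.family w := by
  simp [family, induce, Subtype.ext_iff]

theorem family_subset {G : DAG V} {S : Set V} (hS : G.IsAncestral S) {w : V} (hw : w ∈ S) :
    G.family w ⊆ S := by
  rintro u (rfl | hu)
  · exact hw
  · exact hS w hw u hu

/-- `T` witnesses the separation of `A` and `B` by `C`, when moralization is restricted to the
families of vertices in `S`. -/
structure IsSeparation (G : DAG V) (S A B C T : Set V) : Prop where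
  subset_union : A ⊆ T ∪ C
  disjoint_right : Disjoint T B
  disjoint_sep : Disjoint T C
  closed : ∀ w ∈ S, ∀ u ∈ G.family w, u ∈ T → ∀ v ∈ G.family w, v ∉ C → v ∈ T

/-- Take for `T` the vertices reachable from `A` by walks avoiding `C`. Families are cliques
covering the moral edges, so closure under families replaces walks, and semi-graphoids can be
compared family by family. -/
theorem mem_markov_iff {G : DAG V} {A B C : Set V} :
    (A, B, C) ∈ G.markov ↔ ∃ T, G.IsSeparation (G.an (A ∪ B ∪ C)) A B C T := by
  set S := G.an (A ∪ B ∪ C) with hSdef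
  have hS : G.IsAncestral S := G.isAncestral_an _
  have hU : A ∪ B ∪ C ⊆ S := G.subset_an _
  change (G.induce S).moral.SeparatedBy (Subtype.val ⁻¹' A) (Subtype.val ⁻¹' B)
    (Subtype.val ⁻¹' C) ↔ _
  constructor
  · intro h
    refine ⟨{v | ∃ (hv : v ∈ S) (a : S), (a : V) ∈ A ∧
      ∃ p : (G.induce S).moral.Walk a ⟨v, hv⟩, ∀ s ∈ p.support, (s : V) ∉ C}, ?_, ?_, ?_, ?_⟩
    · intro a ha
      by_cases haC : a ∈ C
      · exact .inr haC
      · refine .inl ⟨hU (.inl (.inl ha)), ⟨a, hU (.inl (.inl ha))⟩, ha, .nil, ?_⟩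
        simpa using haC
    · rw [Set.disjoint_left]
      rintro b ⟨hb, a, ha, p, hp⟩ hbB
      obtain ⟨s, hs, hsC⟩ := h a ha ⟨b, hb⟩ hbB p
      exact hp s hs hsC
    · rw [Set.disjoint_left]
      rintro c ⟨hc, a, ha, p, hp⟩ hcC
      exact hp _ p.end_mem_support hcC
    · rintro w hw u hu ⟨huS, a, ha, p, hp⟩ v hv hvC
      have hvS := family_subset hS hw hv
      by_cases huv : u = v
      · subst huv
        exact ⟨huS, a, ha, p, hp⟩
      · have hadj : (G.induce S).moral.Adj ⟨u, huS⟩ ⟨v, hvS⟩ :=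
          (moral_adj_iff _).2 ⟨fun e => huv (congrArg Subtype.val e), ⟨w, hw⟩,
            induce_mem_family.2 hu, induce_mem_family.2 hv⟩
        refine ⟨hvS, a, ha, p.concat hadj, fun s hs => ?_⟩
        rw [SimpleGraph.Walk.support_concat] at hs
        simp only [List.mem_append, List.mem_singleton] at hs
        rcases hs with hs | rfl
        · exact hp s hs
        · exact hvC
  · rintro ⟨T, hT⟩ a ha b hb p
    by_contra! hp
    have key : ∀ (a b : S) (p : (G.induce S).moral.Walk a b), (a : V) ∈ T →
        (∀ s ∈ p.support, s ∉ (Subtype.val ⁻¹' C : Set S)) → (b : V) ∈ T := by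
      intro a b p
      induction p with
      | nil => exact fun h _ => h
      | @cons u v w hadj q ih =>
        intro hu hs
        obtain ⟨-, x, hux, hvx⟩ := (moral_adj_iff _).1 hadj
        refine ih (hT.closed x x.2 u (induce_mem_family.1 hux) hu v (induce_mem_family.1 hvx)
          (hs v ?_)) fun s h => hs s ?_
        · simp
        · simp [h]
    have haT : (a : V) ∈ T := (hT.subset_union ha).resolve_right (hp a p.start_mem_support)
    exact Set.disjoint_left.1 hT.disjoint_right (key a b p haT hp) hb

/-! ### The semi-graphoid determines skeleton and immoralities -/

/-- Adjacency in the skeleton. -/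
def Linked (G : DAG V) (u v : V) : Prop :=
  G.Adj u v ∨ G.Adj v u

/-- The configuration `u → w ← v` with `u` and `v` not adjacent. -/
def Immorality (G : DAG V) (u w v : V) : Prop :=
  G.Adj u w ∧ G.Adj v w ∧ u ≠ v ∧ ¬ G.Linked u v

/-- The rest of the ancestral closure of `{u, v}` separates, unless `u` and `v` have a common child
there. This is impossible: every vertex of the closure equals or precedes `u` or `v`. -/
theorem exists_markov_of_not_linked {G : DAG V} {u v : V} (hne : u ≠ v) (h : ¬ G.Linked u v) :
    ∃ C, u ∉ C ∧ v ∉ C ∧ ({u}, {v}, C) ∈ G.markov := by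
  obtain ⟨r, hr, hG⟩ := G.acyclic
  set S := G.an {u, v}
  have hS : G.IsAncestral S := G.isAncestral_an _
  refine ⟨S \ {u, v}, by simp, by simp, mem_markov_iff.2 ⟨{u}, ?_, ?_, ?_, ?_⟩⟩
  · simp
  · simpa using hne
  · simp
  · have hsub : G.an ({u} ∪ {v} ∪ S \ {u, v}) ⊆ S := by
      refine an_subset hS ?_
      rintro x ((rfl | rfl) | hx)
      · exact G.subset_an _ (by simp)
      · exact G.subset_an _ (by simp)
      · exact hx.1
    have hlt : S ⊆ {z | (z = u ∨ r z u) ∨ (z = v ∨ r z v)} := by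
      refine an_subset ?_ ?_
      · rintro z ((rfl | hz) | (rfl | hz)) y hy
        · exact .inl (.inr (hG _ _ hy))
        · exact .inl (.inr (_root_.trans (hG _ _ hy) hz))
        · exact .inr (.inr (hG _ _ hy))
        · exact .inr (.inr (_root_.trans (hG _ _ hy) hz))
      · rintro x (rfl | rfl)
        · exact .inl (.inl rfl)
        · exact .inr (.inl rfl)
    rintro w hw y hu hyu x hx hxC
    obtain rfl : y = u := hyu
    have hwS := hsub hw
    have hxS : x ∈ S := family_subset hS hwS hx
    have hxuv : x = y ∨ x = v := by
      by_contra hcon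
      exact hxC ⟨hxS, by simpa using hcon⟩
    rcases hxuv with rfl | rfl
    · rfl
    exfalso
    rcases hu with rfl | hu <;> rcases hx with rfl | hx
    · exact hne rfl
    · exact h (.inr hx)
    · exact h (.inl hu)
    · rcases hlt hwS with (rfl | hz) | (rfl | hz)
      · exact G.not_adj_self _ hu
      · exact asymm_of r hz (hG _ _ hu)
      · exact G.not_adj_self _ hx
      · exact asymm_of r hz (hG _ _ hx)

theorem IsSeparation.mem_of_linked {G : DAG V} {S A B C T : Set V}
    (hT : G.IsSeparation S A B C T) {u v : V} (hu : u ∈ S) (hv : v ∈ S) (h : G.Linked u v)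
    (huT : u ∈ T) (hvC : v ∉ C) : v ∈ T := by
  rcases h with h | h
  · exact hT.closed v hv u (.inr h) huT v (.inl rfl) hvC
  · exact hT.closed u hu u (.inl rfl) huT v (.inr h) hvC

theorem not_markov_of_linked {G : DAG V} {u v : V} (h : G.Linked u v) {C : Set V} (hu : u ∉ C)
    (hv : v ∉ C) : ({u}, {v}, C) ∉ G.markov := by
  intro hM
  obtain ⟨T, hT⟩ := mem_markov_iff.1 hM
  have huT : u ∈ T := (hT.subset_union rfl).resolve_right hu
  refine Set.disjoint_left.1 hT.disjoint_right (hT.mem_of_linked ?_ ?_ h huT hv) rfl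
  · exact G.subset_an _ (by simp)
  · exact G.subset_an _ (by simp)

theorem linked_of_markov_eq {G G' : DAG V} (hM : G.markov = G'.markov) {u v : V}
    (h : G.Linked u v) : G'.Linked u v := by
  by_contra h'
  have hne : u ≠ v := by
    rintro rfl
    exact h.elim (G.not_adj_self u) (G.not_adj_self u)
  obtain ⟨C, hu, hv, hC⟩ := exists_markov_of_not_linked hne h'
  exact not_markov_of_linked h hu hv (hM ▸ hC)

theorem immorality_of_markov_eq {G G' : DAG V} (hM : G.markov = G'.markov) {u w v : V}
    (h : G.Immorality u w v) : G'.Immorality u w v := by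
  obtain ⟨hu, hv, hne, hn⟩ := h
  have hu' : G'.Linked u w := linked_of_markov_eq hM (.inl hu)
  have hv' : G'.Linked w v := linked_of_markov_eq hM (.inr hv)
  have hn' : ¬ G'.Linked u v := fun h => hn (linked_of_markov_eq hM.symm h)
  obtain ⟨C, huC, hvC, hC⟩ := exists_markov_of_not_linked hne hn
  -- Otherwise the common child `w` would lie in the ancestral set and join `u` to `v` in the moral
  -- graph.
  have hwC : w ∉ C := by
    intro hwC
    obtain ⟨T, hT⟩ := mem_markov_iff.1 hC
    have huT : u ∈ T := (hT.subset_union rfl).resolve_right huC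
    exact Set.disjoint_left.1 hT.disjoint_right
      (hT.closed w (G.subset_an _ (.inr hwC)) u (.inr hu) huT v (.inr hv) hvC) rfl
  rw [hM] at hC
  obtain ⟨T, hT⟩ := mem_markov_iff.1 hC
  have huT : u ∈ T := (hT.subset_union rfl).resolve_right huC
  set S := G'.an ({u} ∪ {v} ∪ C)
  have huS : u ∈ S := G'.subset_an _ (by simp)
  have hvS : v ∈ S := G'.subset_an _ (by simp)
  -- Otherwise `u - w - v` would be a path avoiding `C`. As `S` is ancestral, no arrow leads from
  -- `w` to `u` or `v`.
  have hwS : w ∉ S := fun hwS => Set.disjoint_left.1 hT.disjoint_right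
    (hT.mem_of_linked hwS hvS hv' (hT.mem_of_linked huS hwS hu' huT hwC) hvC) rfl
  refine ⟨hu'.resolve_right fun h => hwS ?_, hv'.resolve_left fun h => hwS ?_, hne, hn'⟩
  · exact G'.isAncestral_an _ u huS w h
  · exact G'.isAncestral_an _ v hvS w h

/-! ### Reversal of covered arrows -/

/-- An arrow `x → y` is covered if `y` has the same parents as `x`, apart from `x` itself. -/
def Covered (G : DAG V) (x y : V) : Prop :=
  ∀ z, G.Adj z y ↔ z = x ∨ G.Adj z x

theorem Covered.adj {G : DAG V} {x y : V} (h : G.Covered x y) : G.Adj x y :=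
  (h x).2 (.inl rfl)

/-- The DAG obtained by reversing a covered arrow. -/
def reverse (G : DAG V) {x y : V} (h : G.Covered x y) : DAG V where
  Adj u v := (G.Adj u v ∧ ¬ (u = x ∧ v = y)) ∨ (u = y ∧ v = x)
  acyclic := by
    have hwf : WellFounded fun u v => (G.Adj u v ∧ ¬ (u = x ∧ v = y)) ∨ (u = y ∧ v = x) := by
      refine ⟨fun z => ?_⟩
      induction z using G.wellFounded_adj.induction with
      | _ z ih =>
        refine ⟨_, ?_⟩
        rintro u (⟨hu, -⟩ | ⟨rfl, rfl⟩)
        · exact ih u hu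
        -- The only new predecessor of `x` is `y`, whose remaining parents were already parents of
        -- `x`.
        · refine ⟨_, ?_⟩
          rintro p (⟨hp, hne⟩ | ⟨-, e⟩)
          · exact ih p (((h p).1 hp).resolve_left fun e => hne ⟨e, rfl⟩)
          · exact (G.not_adj_self _ (e ▸ h.adj)).elim
    obtain ⟨s, hs, hwo⟩ := (@IsWellFounded.exists_well_order_ge V _ ⟨hwf⟩)
    exact ⟨s, hwo, fun u v huv => hs u v huv⟩

theorem reverse_adj {G : DAG V} {x y : V} (h : G.Covered x y) {u v : V} :
    (G.reverse h).Adj u v ↔ (G.Adj u v ∧ ¬ (u = x ∧ v = y)) ∨ (u = y ∧ v = x) :=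
  Iff.rfl

theorem Covered.ne {G : DAG V} {x y : V} (h : G.Covered x y) : x ≠ y := by
  rintro rfl
  exact G.not_adj_self _ h.adj

theorem covered_reverse {G : DAG V} {x y : V} (h : G.Covered x y) :
    (G.reverse h).Covered y x := by
  intro z
  have h1 := h z
  have h2 := h.ne
  have h3 := G.not_adj_self x
  have h4 := G.not_adj_symm h.adj
  simp only [reverse_adj]
  grind

theorem reverse_reverse {G : DAG V} {x y : V} (h : G.Covered x y) :
    (G.reverse h).reverse (covered_reverse h) = G := by
  refine ext_adj fun u v => ?_
  have h2 := h.ne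
  have h3 := h.adj
  have h4 := G.not_adj_symm h.adj
  simp only [reverse_adj]
  grind

theorem reverse_family {G : DAG V} {x y w : V} (h : G.Covered x y) (hx : w ≠ x) (hy : w ≠ y) :
    (G.reverse h).family w = G.family w := by
  ext u
  simp [family, reverse_adj, hx, hy]

theorem reverse_family_left {G : DAG V} {x y : V} (h : G.Covered x y) :
    (G.reverse h).family x = G.family y := by
  ext u
  have h1 := h u
  have h2 := h.ne
  simp only [family, reverse_adj, Set.mem_ofPred_eq]
  grind

theorem reverse_family_right {G : DAG V} {x y : V} (h : G.Covered x y) :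
    (G.reverse h).family y ⊆ G.family y := by
  intro u
  have h2 := h.ne
  simp only [family, reverse_adj, Set.mem_ofPred_eq]
  grind

theorem family_of_covered {G : DAG V} {x y : V} (h : G.Covered x y) :
    G.family y = insert y (G.family x) := by
  ext u
  simp [family, h u]

theorem isAncestral_iff_family {G : DAG V} {S : Set V} :
    G.IsAncestral S ↔ ∀ w ∈ S, G.family w ⊆ S :=
  ⟨fun h _ hw => family_subset h hw, fun h w hw _ hu => h w hw (.inr hu)⟩

/-- Reversal changes only the families of `x` and `y`, both ending up inside the old family of `y`.
If `y ∈ S` whenever `x ∈ S`, each new family sits in an old one, and `T` still works. Otherwise the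
ancestral set can grow only by `y`, which avoids `A`, `B` and `C`. -/
theorem markov_subset_reverse {G : DAG V} {x y : V} (h : G.Covered x y) :
    G.markov ⊆ (G.reverse h).markov := by
  rintro ⟨A, B, C⟩ hM
  obtain ⟨T, hT⟩ := mem_markov_iff.1 hM
  rw [mem_markov_iff]
  set S := G.an (A ∪ B ∪ C)
  set S' := (G.reverse h).an (A ∪ B ∪ C)
  have hS : G.IsAncestral S := G.isAncestral_an _
  have hU : A ∪ B ∪ C ⊆ S := G.subset_an _
  by_cases hcase : x ∈ S ∧ y ∉ S
  · obtain ⟨hx, hy⟩ := hcase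
    have hFS : ∀ w ∈ S, ∀ u ∈ G.family w, u ≠ y := fun w hw u hu e =>
      hy (e ▸ family_subset hS hw hu)
    have hfam : ∀ w ∈ insert y S, w = x ∨ w = y →
        (G.reverse h).family w ⊆ insert y (G.family x) := by
      rintro w - (rfl | rfl)
      · rw [reverse_family_left, family_of_covered h]
      · rw [← family_of_covered h]
        exact reverse_family_right h
    have hanc : (G.reverse h).IsAncestral (insert y S) := by
      rw [isAncestral_iff_family]
      intro w hw
      by_cases hwxy : w = x ∨ w = y
      · exact (hfam w hw hwxy).trans (Set.insert_subset_insert (family_subset hS hx))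
      · push Not at hwxy
        rw [reverse_family h hwxy.1 hwxy.2]
        exact (family_subset hS (hw.resolve_left hwxy.2)).trans (Set.subset_insert _ _)
    have hsub : S' ⊆ insert y S := an_subset hanc (hU.trans (Set.subset_insert _ _))
    -- The vertex `y` joins the side of separation on which the family of `x` lies.
    refine ⟨{v | (v ≠ y ∧ v ∈ T) ∨ (v = y ∧ ∃ p ∈ G.family x, p ∈ T)}, ?_, ?_, ?_, ?_⟩
    · intro a ha
      refine (hT.subset_union ha).imp_left fun haT => .inl ⟨?_, haT⟩
      rintro rfl
      exact hy (hU (.inl (.inl ha)))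
    · rw [Set.disjoint_left]
      rintro b (⟨-, hb⟩ | ⟨rfl, -⟩) hbB
      · exact Set.disjoint_left.1 hT.disjoint_right hb hbB
      · exact hy (hU (.inl (.inr hbB)))
    · rw [Set.disjoint_left]
      rintro c (⟨-, hc⟩ | ⟨rfl, -⟩) hcC
      · exact Set.disjoint_left.1 hT.disjoint_sep hc hcC
      · exact hy (hU (.inr hcC))
    · intro w hw u hu huT v hv hvC
      by_cases hwxy : w = x ∨ w = y
      · have hu' := hfam w (hsub hw) hwxy hu
        have hv' := hfam w (hsub hw) hwxy hv
        obtain ⟨p, hp, hpT⟩ : ∃ p ∈ G.family x, p ∈ T := by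
          rcases huT with ⟨huy, huT⟩ | ⟨-, hp⟩
          · exact ⟨u, hu'.resolve_left huy, huT⟩
          · exact hp
        by_cases hvy : v = y
        · exact .inr ⟨hvy, p, hp, hpT⟩
        · exact .inl ⟨hvy, hT.closed x hx p hp hpT v (hv'.resolve_left hvy) hvC⟩
      · push Not at hwxy
        rw [reverse_family h hwxy.1 hwxy.2] at hu hv
        have hwS := (hsub hw).resolve_left hwxy.2
        have huT' : u ∈ T := huT.elim (fun h => h.2) fun h => (hFS w hwS u hu h.1).elim
        exact .inl ⟨hFS w hwS v hv, hT.closed w hwS u hu huT' v hv hvC⟩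
  · have hfam : ∀ w ∈ S, ∃ w' ∈ S, (G.reverse h).family w ⊆ G.family w' := by
      intro w hw
      by_cases hwx : w = x
      · subst hwx
        exact ⟨y, by_contra fun hy => hcase ⟨hw, hy⟩, (reverse_family_left h).subset⟩
      by_cases hwy : w = y
      · subst hwy
        exact ⟨w, hw, reverse_family_right h⟩
      exact ⟨w, hw, (reverse_family h hwx hwy).subset⟩
    have hsub : S' ⊆ S := by
      refine an_subset (isAncestral_iff_family.2 fun w hw => ?_) hU
      obtain ⟨w', hw', hsub⟩ := hfam w hw
      exact hsub.trans (family_subset hS hw')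
    refine ⟨T, hT.subset_union, hT.disjoint_right, hT.disjoint_sep, ?_⟩
    intro w hw u hu huT v hv hvC
    obtain ⟨w', hw', hsub'⟩ := hfam w (hsub hw)
    exact hT.closed w' hw' u (hsub' hu) huT v (hsub' hv) hvC

/-- Reversing a covered arrow preserves the semi-graphoid. -/
theorem markov_reverse {G : DAG V} {x y : V} (h : G.Covered x y) :
    (G.reverse h).markov = G.markov := by
  refine Set.Subset.antisymm ?_ (markov_subset_reverse h)
  have := markov_subset_reverse (covered_reverse h)
  rwa [reverse_reverse] at this

/-! ### Skeleton and immoralities determine the semi-graphoid -/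

/-- Two DAGs have the same skeleton and the same immoralities. -/
structure SamePattern (G G' : DAG V) : Prop where
  linked : ∀ u v, G.Linked u v ↔ G'.Linked u v
  immorality : ∀ u w v, G.Immorality u w v ↔ G'.Immorality u w v

theorem samePattern_of_markov_eq {G G' : DAG V} (h : G.markov = G'.markov) :
    G.SamePattern G' :=
  ⟨fun _ _ => ⟨linked_of_markov_eq h, linked_of_markov_eq h.symm⟩,
    fun _ _ _ => ⟨immorality_of_markov_eq h, immorality_of_markov_eq h.symm⟩⟩

theorem SamePattern.trans {G G' G'' : DAG V} (h : G.SamePattern G') (h' : G'.SamePattern G'') :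
    G.SamePattern G'' :=
  ⟨fun u v => (h.linked u v).trans (h'.linked u v),
    fun u w v => (h.immorality u w v).trans (h'.immorality u w v)⟩

/-- Among the arrows that are reversed between two DAGs with the same skeleton and the same
immoralities, there is a covered one. -/
theorem SamePattern.exists_covered [Finite V] {G G' : DAG V} (h : G.SamePattern G')
    (hex : ∃ x y, G.Adj x y ∧ G'.Adj y x) : ∃ x y, G.Covered x y ∧ G'.Adj y x := by
  -- Choose the head `y` earliest among reversed arrows, then the tail `x` latest among those into
  -- `y`. Arrows into parents of `y` are then unreversed.
  obtain ⟨y, ⟨x₀, hx₀⟩, hymin⟩ := G.wellFounded_adj.has_min {y | ∃ x, G.Adj x y ∧ G'.Adj y x}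
    (by obtain ⟨x, y, hxy⟩ := hex; exact ⟨y, x, hxy⟩)
  obtain ⟨x, ⟨hxy, hyx⟩, hxmax⟩ := G.wellFounded_swap_adj.has_min {x | G.Adj x y ∧ G'.Adj y x}
    ⟨x₀, hx₀⟩
  have hkeep : ∀ p z, G.Adj p y → G.Adj z p → G'.Adj z p := fun p z hp hz =>
    ((h.linked z p).1 (.inl hz)).resolve_right fun hz' => hymin p ⟨z, hz, hz'⟩ hp
  refine ⟨x, y, fun z => ⟨fun hzy => ?_, ?_⟩, hyx⟩
  · by_contra! hcon
    obtain ⟨hne, hzx⟩ := hcon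
    -- If linked, `x → z` survives in `G'`, so acyclicity reverses `z → y`, against the choice of
    -- `x`. If not, the immorality `z → y ← x` survives, against `y → x`.
    by_cases hlink : G.Linked z x
    · have hxz : G.Adj x z := hlink.resolve_left hzx
      have hxz' : G'.Adj x z := hkeep z x hzy hxz
      have hyz' : G'.Adj y z := ((h.linked z y).1 (.inl hzy)).resolve_left
        fun hzy' => G'.not_adj_cycle hxz' hzy' hyx
      exact hxmax z ⟨hzy, hyz'⟩ hxz
    · exact G'.not_adj_symm hyx ((h.immorality z y x).1 ⟨hzy, hxy, hne, hlink⟩).2.1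
  · rintro (rfl | hzx)
    · exact hxy
    · have hzx' : G'.Adj z x := hkeep x z hxy hzx
      have hyz : ¬ G.Adj y z := G.not_adj_cycle hzx hxy
      -- Otherwise `z → x ← y` is an immorality of `G'` but not of `G`.
      by_contra hzy
      have hne : z ≠ y := by
        rintro rfl
        exact G.not_adj_symm hxy hzx
      have hlink : ¬ G'.Linked z y := fun hl => ((h.linked z y).2 hl).elim hzy hyz
      exact G.not_adj_symm hxy ((h.immorality z x y).2 ⟨hzx', hyx, hne, hlink⟩).2.1

/-- DAGs with the same skeleton and the same immoralities are Markov equivalent. -/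
theorem SamePattern.markov_eq [Finite V] {G G' : DAG V} (h : G.SamePattern G') :
    G.markov = G'.markov := by
  -- Induction on the number of reversed arrows; with none left, the common skeleton forces
  -- equality.
  induction hn : {e : V × V | G.Adj e.1 e.2 ∧ G'.Adj e.2 e.1}.ncard using Nat.strong_induction_on
    generalizing G with
  | _ n ih =>
    by_cases hex : ∃ x y, G.Adj x y ∧ G'.Adj y x
    · obtain ⟨x, y, hc, hyx⟩ := h.exists_covered hex
      rw [← markov_reverse hc]
      refine ih _ ?_ ((samePattern_of_markov_eq (markov_reverse hc)).trans h) rfl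
      rw [← hn]
      refine Set.ncard_lt_ncard ⟨?_, fun hsub => ?_⟩ (Set.toFinite _)
      · rintro ⟨u, v⟩ ⟨hu | ⟨rfl, rfl⟩, hv⟩
        · exact ⟨hu.1, hv⟩
        · exact (G'.not_adj_symm hyx hv).elim
      · obtain ⟨hxy | ⟨e, -⟩, -⟩ := @hsub (x, y) ⟨hc.adj, hyx⟩
        · exact hxy.2 ⟨rfl, rfl⟩
        · exact hc.ne e
    · push Not at hex
      congr 1
      refine ext_adj fun u v => ⟨fun huv => ?_, fun huv => ?_⟩
      · exact ((h.linked u v).1 (.inl huv)).resolve_right (hex u v huv)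
      · exact ((h.linked u v).2 (.inl huv)).resolve_right fun hvu => hex v u hvu huv

theorem markov_eq_iff_samePattern [Finite V] {G G' : DAG V} :
    G.markov = G'.markov ↔ G.SamePattern G' :=
  ⟨samePattern_of_markov_eq, SamePattern.markov_eq⟩

theorem IsComplete.samePattern {G G' : DAG V} (h : G.IsComplete) (h' : G'.IsComplete) :
    G.SamePattern G' := by
  have hl : ∀ {K : DAG V}, K.IsComplete → ∀ u v, K.Linked u v ↔ u ≠ v := by
    refine fun {K} hK u v => ⟨?_, hK u v⟩
    rintro hl rfl
    exact hl.elim (K.not_adj_self u) (K.not_adj_self u)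
  refine ⟨fun u v => (hl h u v).trans (hl h' u v).symm, fun u w v => ⟨?_, ?_⟩⟩
  · rintro ⟨-, -, hne, hn⟩
    exact (hn (h u v hne)).elim
  · rintro ⟨-, -, hne, hn⟩
    exact (hn (h' u v hne)).elim

/-! ### Insertion and restriction of DAGs -/

section Ancestral

variable {A : Set V}

theorem insertion_adj {H : DAG A} {G : DAG V} {hA : G.IsAncestral A} {u v : V} :
    (H.insertion G hA).Adj u v ↔ (∃ (hu : u ∈ A) (hv : v ∈ A), H.Adj ⟨u, hu⟩ ⟨v, hv⟩) ∨
      (G.Adj u v ∧ ¬ (u ∈ A ∧ v ∈ A)) :=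
  Iff.rfl

theorem insertion_adj_of_mem {H : DAG A} {G : DAG V} {hA : G.IsAncestral A} {u v : V}
    (hu : u ∈ A) (hv : v ∈ A) : (H.insertion G hA).Adj u v ↔ H.Adj ⟨u, hu⟩ ⟨v, hv⟩ := by
  simp [insertion_adj, hu, hv]

theorem insertion_adj_of_not_mem {H : DAG A} {G : DAG V} {hA : G.IsAncestral A} {u v : V}
    (h : ¬ (u ∈ A ∧ v ∈ A)) : (H.insertion G hA).Adj u v ↔ G.Adj u v := by
  rw [insertion_adj]
  refine ⟨?_, fun h' => .inr ⟨h', h⟩⟩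
  rintro (⟨hu, hv, -⟩ | h')
  · exact (h ⟨hu, hv⟩).elim
  · exact h'.1

theorem insertion_linked_of_mem {H : DAG A} {G : DAG V} {hA : G.IsAncestral A} {u v : V}
    (hu : u ∈ A) (hv : v ∈ A) : (H.insertion G hA).Linked u v ↔ H.Linked ⟨u, hu⟩ ⟨v, hv⟩ :=
  or_congr (insertion_adj_of_mem hu hv) (insertion_adj_of_mem hv hu)

theorem insertion_linked_of_not_mem {H : DAG A} {G : DAG V} {hA : G.IsAncestral A} {u v : V}
    (h : ¬ (u ∈ A ∧ v ∈ A)) : (H.insertion G hA).Linked u v ↔ G.Linked u v :=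
  or_congr (insertion_adj_of_not_mem h) (insertion_adj_of_not_mem fun h' => h h'.symm)

theorem IsAncestral.adj_iff_linked {G : DAG V} (hA : G.IsAncestral A) {u w : V} (hu : u ∈ A)
    (hw : w ∉ A) : G.Adj u w ↔ G.Linked u w :=
  ⟨.inl, fun h => h.resolve_right fun h' => hw (hA u hu w h')⟩

/-- An immorality with middle vertex in `A` lies within `A`, so comes from `H`. Otherwise its two
arrows come from `G`. -/
theorem SamePattern.insertion {H H' : DAG A} {G G' : DAG V} (hH : H.SamePattern H')
    (hG : G.SamePattern G') (hA : G.IsAncestral A) (hA' : G'.IsAncestral A) :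
    (H.insertion G hA).SamePattern (H'.insertion G' hA') := by
  have hl : ∀ u v, (H.insertion G hA).Linked u v ↔ (H'.insertion G' hA').Linked u v := by
    intro u v
    by_cases h : u ∈ A ∧ v ∈ A
    · rw [insertion_linked_of_mem h.1 h.2, insertion_linked_of_mem h.1 h.2, hH.linked]
    · rw [insertion_linked_of_not_mem h, insertion_linked_of_not_mem h, hG.linked]
  have key : ∀ {H H' : DAG A} {G G' : DAG V} (hH : H.SamePattern H') (hG : G.SamePattern G')
      (hA : G.IsAncestral A) (hA' : G'.IsAncestral A)
      (hl : ∀ u v, (H.insertion G hA).Linked u v ↔ (H'.insertion G' hA').Linked u v) (u w v : V),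
      (H.insertion G hA).Immorality u w v → (H'.insertion G' hA').Immorality u w v := by
    rintro H H' G G' hH hG hA hA' hl u w v ⟨huw, hvw, hne, hn⟩
    have hn' : ¬ (H'.insertion G' hA').Linked u v := fun h => hn ((hl u v).2 h)
    by_cases hw : w ∈ A
    · have hu : u ∈ A := insertion_isAncestral H G hA w hw u huw
      have hv : v ∈ A := insertion_isAncestral H G hA w hw v hvw
      rw [insertion_adj_of_mem hu hw] at huw
      rw [insertion_adj_of_mem hv hw] at hvw
      rw [insertion_linked_of_mem hu hv] at hn
      obtain ⟨h1, h2, -⟩ := (hH.immorality _ _ _).1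
        ⟨huw, hvw, fun e => hne (congrArg Subtype.val e), hn⟩
      exact ⟨(insertion_adj_of_mem hu hw).2 h1, (insertion_adj_of_mem hv hw).2 h2, hne, hn'⟩
    · have hnot : ∀ z, ¬ (z ∈ A ∧ w ∈ A) := fun z h => hw h.2
      rw [insertion_adj_of_not_mem (hnot _)] at huw hvw
      unfold Immorality
      rw [insertion_adj_of_not_mem (hnot _), insertion_adj_of_not_mem (hnot _)]
      -- For `u, v ∈ A` the immorality need not be one of `G`, since `H` decides whether they are
      -- linked; but arrows leaving `A` are determined by the skeleton.
      by_cases h : u ∈ A ∧ v ∈ A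
      · refine ⟨?_, ?_, hne, hn'⟩
        · rw [hA'.adj_iff_linked h.1 hw, ← hG.linked]
          exact .inl huw
        · rw [hA'.adj_iff_linked h.2 hw, ← hG.linked]
          exact .inl hvw
      · rw [insertion_linked_of_not_mem h] at hn
        obtain ⟨h1, h2, -⟩ := (hG.immorality _ _ _).1 ⟨huw, hvw, hne, hn⟩
        exact ⟨h1, h2, hne, hn'⟩
  have hH' : H'.SamePattern H :=
    ⟨fun u v => (hH.linked u v).symm, fun u w v => (hH.immorality u w v).symm⟩
  have hG' : G'.SamePattern G :=
    ⟨fun u v => (hG.linked u v).symm, fun u w v => (hG.immorality u w v).symm⟩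
  exact ⟨hl, fun u w v => ⟨key hH hG hA hA' hl u w v,
    key hH' hG' hA' hA (fun u v => (hl u v).symm) u w v⟩⟩

theorem induce_linked {G : DAG V} {u v : A} :
    (G.induce A).Linked u v ↔ G.Linked u v :=
  Iff.rfl

theorem induce_immorality {G : DAG V} {u w v : A} :
    (G.induce A).Immorality u w v ↔ G.Immorality u w v := by
  rw [Immorality, Immorality, induce_linked, ← Subtype.coe_ne_coe]
  rfl

theorem SamePattern.induce {G G' : DAG V} (h : G.SamePattern G') (A : Set V) :
    (G.induce A).SamePattern (G'.induce A) :=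
  ⟨fun u v => by rw [induce_linked, induce_linked, h.linked],
    fun u w v => by rw [induce_immorality, induce_immorality, h.immorality]⟩

theorem induce_insertion (H : DAG A) (G : DAG V) (hA : G.IsAncestral A) :
    (H.insertion G hA).induce A = H :=
  ext_adj fun u v => insertion_adj_of_mem (hA := hA) u.2 v.2

theorem insertion_insertion (H H' : DAG A) (G : DAG V) (hA : G.IsAncestral A) :
    H.insertion (H'.insertion G hA) (insertion_isAncestral H' G hA) = H.insertion G hA := by
  refine ext_adj fun u v => ?_
  by_cases h : u ∈ A ∧ v ∈ A
  · rw [insertion_adj_of_mem h.1 h.2, insertion_adj_of_mem h.1 h.2]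
  · rw [insertion_adj_of_not_mem h, insertion_adj_of_not_mem h, insertion_adj_of_not_mem h]

theorem insertion_induce (G : DAG V) (hA : G.IsAncestral A) :
    (G.induce A).insertion G hA = G := by
  refine ext_adj fun u v => ?_
  by_cases h : u ∈ A ∧ v ∈ A
  · rw [insertion_adj_of_mem h.1 h.2]
    rfl
  · rw [insertion_adj_of_not_mem h]

end Ancestral

end DAG

/-! ### Descent to dagoids -/

namespace Dagoid

variable {V : Type*} {A : Set V}

theorem mk_eq_mk_iff {G G' : DAG V} : mk G = mk G' ↔ G.markov = G'.markov :=
  Quotient.eq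

theorem mk_eq_mk_iff_samePattern [Finite V] {G G' : DAG V} :
    mk G = mk G' ↔ G.SamePattern G' :=
  mk_eq_mk_iff.trans DAG.markov_eq_iff_samePattern

theorem induced_mk [Finite V] (G : DAG V) (hG : G.IsAncestral A) :
    induced ⟨mk G, mk_mem_ances hG⟩ = mk (G.induce A) :=
  mk_eq_mk_iff_samePattern.2 ((mk_eq_mk_iff_samePattern.1 (mk_rep _)).induce A)

theorem insertion_mk [Finite V] (H : DAG A) (G : DAG V) (hG : G.IsAncestral A) :
    insertion (mk H) ⟨mk G, mk_mem_ances hG⟩ =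
      ⟨mk (H.insertion G hG), mk_mem_ances (DAG.insertion_isAncestral H G hG)⟩ :=
  Subtype.ext <| mk_eq_mk_iff_samePattern.2 <|
    (mk_eq_mk_iff_samePattern.1 (Quotient.out_eq (mk H))).insertion
      (mk_eq_mk_iff_samePattern.1 (mk_rep _)) _ _

theorem remainder_mk [Finite V] (C : DAG A) (G : DAG V) (hG : G.IsAncestral A)
    (hC : C.IsComplete) :
    remainder ⟨mk G, mk_mem_ances hG⟩ =
      ⟨mk (C.insertion G hG), mk_mem_ances (DAG.insertion_isAncestral C G hG)⟩ := by
  rw [remainder, complete,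
    mk_eq_mk_iff_samePattern.2 (DAG.isComplete_complete.samePattern hC), insertion_mk]

theorem ances_ind {p : ances A → Prop}
    (h : ∀ (G : DAG V) (hG : G.IsAncestral A), p ⟨mk G, mk_mem_ances hG⟩) (D : ances A) : p D := by
  obtain ⟨_, G, rfl, hG⟩ := D
  exact h G hG

theorem insertion_remainder [Finite V] (K : Dagoid A) (D : ances A) :
    insertion K (remainder D) = insertion K D := by
  induction K using Quotient.inductionOn with
  | _ H =>
    induction D using ances_ind with
    | _ G hG =>
      change insertion (mk H) _ = insertion (mk H) _
      rw [remainder_mk _ G hG DAG.isComplete_complete,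
        insertion_mk H _ (DAG.insertion_isAncestral _ G hG), insertion_mk H G hG]
      exact Subtype.ext (congrArg mk (DAG.insertion_insertion _ _ _ _))

theorem induced_insertion [Finite V] (K : Dagoid A) (D : ances A) :
    induced (insertion K D) = K := by
  induction K using Quotient.inductionOn with
  | _ H =>
    induction D using ances_ind with
    | _ G hG =>
      change induced (insertion (mk H) _) = mk H
      rw [insertion_mk H G hG, induced_mk _ (DAG.insertion_isAncestral _ G hG),
        DAG.induce_insertion]

theorem remainder_insertion [Finite V] (K : Dagoid A) (D : ances A) :
    remainder (insertion K D) = remainder D := by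
  induction K using Quotient.inductionOn with
  | _ H =>
    induction D using ances_ind with
    | _ G hG =>
      change remainder (insertion (mk H) _) = _
      rw [insertion_mk H G hG, remainder_mk _ G hG DAG.isComplete_complete,
        remainder_mk _ _ (DAG.insertion_isAncestral _ G hG) DAG.isComplete_complete]
      exact Subtype.ext (congrArg mk (DAG.insertion_insertion _ _ _ _))

theorem insertion_induced [Finite V] (D : ances A) : insertion (induced D) D = D := by
  induction D using ances_ind with
  | _ G hG =>
    rw [induced_mk G hG, insertion_mk _ G hG]
    exact Subtype.ext (congrArg mk (DAG.insertion_induce _ _))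

theorem variationIndep_induced_remainder [Finite V] (A : Set V) :
    VariationIndep (fun D : ances A => induced D) (fun D : ances A => remainder D) := by
  refine Set.Subset.antisymm ?_ ?_
  · rintro _ ⟨D, rfl⟩
    exact ⟨⟨D, rfl⟩, ⟨D, rfl⟩⟩
  · rintro ⟨_, _⟩ ⟨⟨D, rfl⟩, ⟨D', rfl⟩⟩
    exact ⟨insertion (induced D) D',
      Prod.ext (induced_insertion _ _) (remainder_insertion _ _)⟩

end Dagoid

theorem mainTheorem9 {V : Type*} [Finite V] (A : Set V) :
    -- the three operations do not depend on the choice of representatives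
    (∀ (G : DAG V) (hG : G.IsAncestral A),
      Dagoid.induced ⟨Dagoid.mk G, Dagoid.mk_mem_ances hG⟩ = Dagoid.mk (G.induce A)) ∧
    (∀ (H : DAG A) (G : DAG V) (hG : G.IsAncestral A),
      (Dagoid.insertion (Dagoid.mk H) ⟨Dagoid.mk G, Dagoid.mk_mem_ances hG⟩ : Dagoid V) =
        Dagoid.mk (H.insertion G hG)) ∧
    (∀ (C : DAG A) (G : DAG V) (hG : G.IsAncestral A), C.IsComplete →
      (Dagoid.remainder ⟨Dagoid.mk G, Dagoid.mk_mem_ances hG⟩ : Dagoid V) =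
        Dagoid.mk (C.insertion G hG)) ∧
    -- variation independence, over the dagoids in which `A` is ancestral
    VariationIndep (fun D : Dagoid.ances A => Dagoid.induced D)
      (fun D : Dagoid.ances A => Dagoid.remainder D) ∧
    -- each pair is realised by the ancestral insertion, and by no other dagoid
    (∀ D D' : Dagoid.ances A,
      Dagoid.induced (Dagoid.insertion (Dagoid.induced D) (Dagoid.remainder D')) =
        Dagoid.induced D ∧
      Dagoid.remainder (Dagoid.insertion (Dagoid.induced D) (Dagoid.remainder D')) =
        Dagoid.remainder D' ∧
      ∀ E : Dagoid.ances A, Dagoid.induced E = Dagoid.induced D →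
        Dagoid.remainder E = Dagoid.remainder D' →
        E = Dagoid.insertion (Dagoid.induced D) (Dagoid.remainder D')) := by
  refine ⟨Dagoid.induced_mk, fun H G hG => congrArg Subtype.val (Dagoid.insertion_mk H G hG),
    fun C G hG hC => congrArg Subtype.val (Dagoid.remainder_mk C G hG hC),
    Dagoid.variationIndep_induced_remainder A, fun D D' => ?_⟩
  refine ⟨Dagoid.induced_insertion _ _, ?_, fun E hE hE' => ?_⟩
  · rw [Dagoid.insertion_remainder, Dagoid.remainder_insertion]
  -- Uniqueness: `E` is recovered as E_A ⋉ E_{V|A} = E_A ⋉ E = E.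
  · rw [← hE, ← hE', Dagoid.insertion_remainder, Dagoid.insertion_induced]
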